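/- Let $n>k\ge 0$ be integers and let $T$ be a $k$-dimensional $\mathbb{Q}$-acyclic simplicial complex on $[n]=\{1,\dots,n\}$; that is, $T$ is a $k$-dimensional simplicial complex with vertices in $[n]$ that contains every subset of $[n]$ with at most $k$ elements, has exactly $\binom{n-1}{k}$ faces of dimension $k$, and satisfies $\tilde H_k(T;\mathbb{Q})=0$. Write $\tau\in T$ for the $k$-dimensional faces $\tau$ of $T$, let $d_i$ be the number of $k$-dimensional faces of $T$ that contain the vertex $i$, and put $m_1=\binom{n-2}{k-1}$ (with $m_1=0$ if $k=0$). Then the reduced integral homology group $\tilde H_{k-1}(T)=\tilde H_{k-1}(T;\mathbb{Z})$ is finite and $$|\tilde H_{k-1}(T)|^2\le\inf_{x\in\mathbb{R}^n\setminus\{\mathbf 0\}}\frac{\prod_{i\in[n]}(x_i^2)^{m_1-d_i}}{\left(\sum_{i\in[n]}x_i^2\right)^{m_1}}\prod_{\tau\in T}\sum_{i\in\tau}x_i^2,$$ where $0^0=1$ and the expression is read as $+\infty$ if $x_i=0$ for some $i$ with $d_i>m_1$. -/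

import Mathlib

open scoped ENNReal

noncomputable section

namespace QAcyclic

open scoped Classical in
/-- The `k`-dimensional faces of `T`, as a finset of vertex sets. -/
def kFaces {n : ℕ} (T : PreAbstractSimplicialComplex (Fin n)) (k : ℕ) :
    Finset (Finset (Fin n)) :=
  Finset.univ.filter fun τ => τ ∈ T.faces ∧ τ.card = k + 1

/-- The faces of `T` with exactly `j` vertices, the empty face (dimension `-1`) included. -/
abbrev Face {n : ℕ} (T : PreAbstractSimplicialComplex (Fin n)) (j : ℕ) : Type :=
  {σ : Finset (Fin n) // (σ = ∅ ∨ σ ∈ T.faces) ∧ σ.card = j}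

instance {n : ℕ} (T : PreAbstractSimplicialComplex (Fin n)) (j : ℕ) : Fintype (Face T j) :=
  Fintype.ofFinite _

/-- The simplicial boundary matrix, from faces with `j + 1` vertices to faces with `j` vertices:
the entry at `(σ, τ)` is `(-1) ^ m` if `σ = τ \ {τ_m}`, where `τ = {τ_0 < ⋯ < τ_j}`, and `0`
if there is no such `m`. -/
def boundaryMatrix (R : Type) [CommRing R] {n : ℕ} (T : PreAbstractSimplicialComplex (Fin n))
    (j : ℕ) : Matrix (Face T j) (Face T (j + 1)) R :=
  fun σ τ => ∑ v ∈ τ.1,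
    if σ.1 = τ.1.erase v then (-1) ^ (τ.1.filter fun u => u < v).card else 0

/-- The boundary map `C_j(T; R) → C_{j-1}(T; R)` of the augmented simplicial chain complex. -/
def boundary (R : Type) [CommRing R] {n : ℕ} (T : PreAbstractSimplicialComplex (Fin n))
    (j : ℕ) : (Face T (j + 1) → R) →ₗ[R] (Face T j → R) :=
  (boundaryMatrix R T j).mulVecLin

/-- The reduced cycles supported on faces with `j` vertices, i.e. of dimension `j - 1`. -/
def cycles (R : Type) [CommRing R] {n : ℕ} (T : PreAbstractSimplicialComplex (Fin n)) :
    (j : ℕ) → Submodule R (Face T j → R)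
  | 0 => ⊤
  | j + 1 => LinearMap.ker (boundary R T j)

/-- The boundaries supported on faces with `j` vertices, i.e. of dimension `j - 1`. -/
def boundaries (R : Type) [CommRing R] {n : ℕ} (T : PreAbstractSimplicialComplex (Fin n))
    (j : ℕ) : Submodule R (Face T j → R) :=
  LinearMap.range (boundary R T j)

/-- The reduced simplicial homology group in dimension `j - 1`, that is
`H̃_{j-1}(T; R)`: cycles modulo boundaries among chains on faces with `j` vertices. -/
abbrev RedHomology (R : Type) [CommRing R] {n : ℕ} (T : PreAbstractSimplicialComplex (Fin n))
    (j : ℕ) : Type :=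
  cycles R T j ⧸ (boundaries R T j).submoduleOf (cycles R T j)

/-- `T` is a `k`-dimensional `ℚ`-acyclic complex on the vertex set `[n]`. -/
structure IsQAcyclic {n : ℕ} (T : PreAbstractSimplicialComplex (Fin n)) (k : ℕ) : Prop where
  /-- `T` has a face of dimension `k` -/
  exists_face : ∃ τ ∈ T.faces, τ.card = k + 1
  /-- and no face of larger dimension -/
  card_le : ∀ τ ∈ T.faces, τ.card ≤ k + 1
  /-- the `(k-1)`-skeleton is full -/
  full_skeleton : ∀ σ : Finset (Fin n), σ.Nonempty → σ.card ≤ k → σ ∈ T.faces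
  /-- the number of `k`-faces is `(n-1).choose k` -/
  card_kFaces : (kFaces T k).card = (n - 1).choose k
  /-- the top homology vanishes -/
  top_homology : Subsingleton (RedHomology ℚ T (k + 1))

/-- The degree of a vertex: the number of `k`-faces that contain it. -/
def degree {n : ℕ} (T : PreAbstractSimplicialComplex (Fin n)) (k : ℕ) (i : Fin n) : ℕ :=
  ((kFaces T k).filter fun τ => i ∈ τ).card

/-- The number `m₁ = C(n-2, k-1)`, which is `0` for `k = 0`. -/
def m₁ (n : ℕ) : ℕ → ℕ
  | 0 => 0
  | k + 1 => (n - 2).choose k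

open scoped Classical in
/-- The expression
`∏ᵢ (xᵢ²)^(m₁ - dᵢ) / (∑ᵢ xᵢ²)^m₁ * ∏_τ ∑_{i ∈ τ} xᵢ²`, with `0 ^ 0 = 1`, and with the value `∞`
where it contains a negative power of `0`. -/
def boundExpr {n : ℕ} (T : PreAbstractSimplicialComplex (Fin n)) (k : ℕ) (x : Fin n → ℝ) :
    ℝ≥0∞ :=
  if ∃ i, x i = 0 ∧ m₁ n k < degree T k i then ⊤
  else ENNReal.ofReal
    ((∏ i, (x i ^ 2) ^ ((m₁ n k : ℤ) - (degree T k i : ℤ))) / (∑ i, x i ^ 2) ^ m₁ n k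
      * ∏ τ ∈ kFaces T k, ∑ i ∈ τ, x i ^ 2)

end QAcyclic

end

/-! Weight the simplicial boundary by letting the removal of `v` carry the factor `x v`. The Gram
matrix of the weighted boundaries of the `k`-faces has diagonal entries `∑ i ∈ τ, x i ^ 2`, so
Hadamard's inequality bounds its determinant by the product over faces. When no `x i` vanishes,
`det_gram_mul` evaluates that determinant exactly, and comparing the two gives the bound.

For the evaluation, fix a vertex `v`. Since `∂∂ = 0`, the rows through `v` are combinations of the
rows avoiding `v`, and the Gram matrix becomes `Bᵀ (1 + L) B` (`gram_eq`). Here `B` is the square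
reduced boundary matrix and `L` a down-Laplacian on the other vertices with weights `x u / x v`. The
relation `∂∂ᵀ + ∂ᵀ∂ = |x|²` (`sum_coef_clifford`) yields `det (1 + L)`, and diagonal rescaling turns
`B` into the unweighted matrix `A`.

Over `ℤ`, cycles on `k`-sets restrict isomorphically to chains avoiding `v`. Homology is thus the
cokernel of `A`, of order `|det A|` (`IsQAcyclic.card_redHomology`); vanishing top homology gives
`det A ≠ 0`. Vectors with zero coordinates follow by a limit. -/

namespace QAcyclic

open Finset

/-! ### Signed weighted boundary coefficients and their quadratic identities. -/

section Coef

variable {V : Type*} [LinearOrder V]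

/-- The sign `(-1) ^ m`, where `m` is the number of elements of `σ` below `v`. -/
def vsign (R : Type*) [CommRing R] (σ : Finset V) (v : V) : R :=
  (-1) ^ (σ.filter fun u => u < v).card

/-- The boundary coefficient at `(σ, τ)`, weighted by `x v` where `σ = τ \ {v}`. -/
def coef {R : Type*} [CommRing R] (x : V → R) (σ τ : Finset V) : R :=
  ∑ v ∈ τ, if σ = τ.erase v then x v * vsign R τ v else 0

variable {R : Type*} [CommRing R]

theorem vsign_mul_self (σ : Finset V) (v : V) : vsign R σ v * vsign R σ v = 1 := by
  simp [vsign, ← mul_pow]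

theorem vsign_insert_self (σ : Finset V) (v : V) : vsign R (insert v σ) v = vsign R σ v := by
  simp [vsign, Finset.filter_insert]

theorem vsign_erase_self (σ : Finset V) (v : V) : vsign R (σ.erase v) v = vsign R σ v := by
  simp [vsign, Finset.filter_erase]

theorem vsign_insert {σ : Finset V} {v : V} (hv : v ∉ σ) (w : V) :
    vsign R (insert v σ) w = (if v < w then -1 else 1) * vsign R σ w := by
  unfold vsign
  rw [Finset.filter_insert]
  split_ifs with h
  · rw [Finset.card_insert_of_notMem (by simp [hv]), pow_succ']
  · simp

theorem vsign_eq_erase {σ : Finset V} {w : V} (hw : w ∈ σ) (v : V) :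
    vsign R σ v = (if w < v then -1 else 1) * vsign R (σ.erase w) v := by
  conv_lhs => rw [← Finset.insert_erase hw]
  exact vsign_insert (by simp) v

theorem coef_eq_zero_of_card (x : V → R) {σ τ : Finset V} (h : σ.card + 1 ≠ τ.card) :
    coef x σ τ = 0 := by
  refine Finset.sum_eq_zero fun v hv => if_neg ?_
  rintro rfl
  exact h (Finset.card_erase_add_one hv)

theorem coef_eq_zero_of_not_subset (x : V → R) {σ τ : Finset V} (h : ¬ σ ⊆ τ) :
    coef x σ τ = 0 := by
  refine Finset.sum_eq_zero fun v _ => if_neg ?_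
  rintro rfl
  exact h (Finset.erase_subset _ _)

theorem coef_erase (x : V → R) {τ : Finset V} {v : V} (hv : v ∈ τ) :
    coef x (τ.erase v) τ = x v * vsign R τ v := by
  unfold coef
  rw [Finset.sum_eq_single_of_mem v hv, if_pos rfl]
  intro w hw hwv
  refine if_neg fun h => ?_
  have : w ∈ τ.erase v := by simp [hw, hwv]
  rw [h] at this
  simp at this

theorem coef_insert (x : V → R) {σ : Finset V} {v : V} (hv : v ∉ σ) :
    coef x σ (insert v σ) = x v * vsign R σ v := by
  have := coef_erase x (Finset.mem_insert_self v σ)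
  rwa [Finset.erase_insert hv, vsign_insert_self] at this

theorem coef_congr {x y : V → R} {σ τ : Finset V} (h : ∀ v ∈ τ, x v = y v) :
    coef x σ τ = coef y σ τ :=
  Finset.sum_congr rfl fun v hv => by rw [h v hv]

theorem coef_smul (c : R) (x : V → R) (σ τ : Finset V) :
    coef (fun v => c * x v) σ τ = c * coef x σ τ := by
  simp only [coef, Finset.mul_sum, mul_ite, mul_zero, mul_assoc]

theorem map_coef {S : Type*} [CommRing S] (f : R →+* S) (x : V → R) (σ τ : Finset V) :
    f (coef x σ τ) = coef (fun v => f (x v)) σ τ := by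
  simp only [coef, map_sum, vsign]
  refine Finset.sum_congr rfl fun v _ => ?_
  split_ifs <;> simp

/-- Weighting only rescales rows and columns: removing `v` divides the monomial of `τ` by exactly `x
v`. -/
theorem coef_mul_prod (x : V → R) (σ τ : Finset V) :
    coef x σ τ * ∏ i ∈ σ, x i = coef (fun _ => (1 : R)) σ τ * ∏ i ∈ τ, x i := by
  simp only [coef, Finset.sum_mul]
  refine Finset.sum_congr rfl fun v hv => ?_
  split_ifs with h
  · rw [h, ← Finset.mul_prod_erase τ x hv]; ring
  · simp

variable [Fintype V]

theorem sum_coef_mul_left (x : V → R) (τ : Finset V) (F : Finset V → R) :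
    ∑ σ, coef x σ τ * F σ = ∑ v ∈ τ, x v * vsign R τ v * F (τ.erase v) := by
  simp only [coef, Finset.sum_mul]
  rw [Finset.sum_comm]
  refine Finset.sum_congr rfl fun v _ => ?_
  simp [ite_mul]

theorem sum_coef_mul_right (x : V → R) (σ : Finset V) (F : Finset V → R) :
    ∑ τ, coef x σ τ * F τ = ∑ v ∈ σᶜ, x v * vsign R σ v * F (insert v σ) := by
  have key : ∀ τ, coef x σ τ * F τ =
      ∑ v ∈ σᶜ, if τ = insert v σ then x v * vsign R σ v * F (insert v σ) else 0 := by
    intro τ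
    by_cases h : ∃ v ∈ σᶜ, τ = insert v σ
    · obtain ⟨v, hv, rfl⟩ := h
      rw [Finset.mem_compl] at hv
      rw [coef_insert x hv, Finset.sum_eq_single_of_mem v (by simpa), if_pos rfl]
      intro w hw hwv
      refine if_neg fun h => ?_
      have : w ∈ insert v σ := h ▸ Finset.mem_insert_self w σ
      simp only [Finset.mem_compl] at hw
      simp [hw, hwv] at this
    · push Not at h
      rw [Finset.sum_eq_zero fun v hv => if_neg (h v hv)]
      have : coef x σ τ = 0 := by
        refine Finset.sum_eq_zero fun v hv => if_neg ?_
        rintro rfl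
        exact h v (by simp) (Finset.insert_erase hv).symm
      simp [this]
  simp only [key]
  rw [Finset.sum_comm]
  simp

theorem sum_coef_mul_coef_self (x : V → R) (τ : Finset V) :
    ∑ σ, coef x σ τ * coef x σ τ = ∑ v ∈ τ, x v ^ 2 := by
  rw [sum_coef_mul_left]
  refine Finset.sum_congr rfl fun v hv => ?_
  rw [coef_erase x hv]
  linear_combination x v ^ 2 * vsign_mul_self (R := R) τ v

/-- `∂∂ = 0`: removing `v, w` in the two orders gives opposite signs. Swapping the sums shows that
the total equals its own negative, whence the assumptions on `R`. -/
theorem sum_coef_mul_coef_eq_zero [NoZeroDivisors R] [CharZero R] (x : V → R)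
    (η τ : Finset V) : ∑ σ, coef x η σ * coef x σ τ = 0 := by
  simp only [mul_comm (coef x η _)]
  rw [sum_coef_mul_left]
  have h1 : ∀ v ∈ τ, x v * vsign R τ v * coef x η (τ.erase v) =
      ∑ w ∈ τ, if v ≠ w ∧ η = (τ.erase v).erase w then
        x v * vsign R τ v * (x w * vsign R (τ.erase v) w) else 0 := by
    intro v hv
    simp only [coef, Finset.mul_sum]
    rw [← Finset.sum_erase_add τ _ hv]
    simp only [ne_eq, not_true_eq_false, false_and, if_false, add_zero]
    refine Finset.sum_congr rfl fun w hw => ?_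
    have : v ≠ w := (Finset.ne_of_mem_erase hw).symm
    simp [this]
  rw [Finset.sum_congr rfl h1]
  refine self_eq_neg.mp ?_
  conv_lhs => rw [Finset.sum_comm]
  rw [← Finset.sum_neg_distrib]
  refine Finset.sum_congr rfl fun v hv => ?_
  rw [← Finset.sum_neg_distrib]
  refine Finset.sum_congr rfl fun w hw => ?_
  simp only [Finset.erase_right_comm (a := v), ne_comm (a := v) (b := w)]
  split_ifs with h
  · rw [vsign_eq_erase hw v, vsign_eq_erase hv w]
    rcases lt_or_gt_of_ne h.1 with h' | h' <;> simp [h', h'.not_gt] <;> ring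
  · simp

/-- Each vertex contributes its square to the diagonal once, through the first sum if it lies
outside `σ` and through the second if inside. Off the diagonal, only `σ' = σ - w + v` matters, and
the two routes to it have opposite signs. -/
theorem sum_coef_clifford (x : V → R) (σ σ' : Finset V) :
    ∑ τ, coef x σ τ * coef x σ' τ + ∑ ρ, coef x ρ σ * coef x ρ σ' =
      if σ = σ' then ∑ v, x v ^ 2 else 0 := by
  rw [sum_coef_mul_left, sum_coef_mul_right]
  have h1 : ∀ v ∈ σᶜ, x v * vsign R σ v * coef x σ' (insert v σ) =
      (if σ = σ' then x v ^ 2 else 0) +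
      ∑ w ∈ σ, if σ' = insert v (σ.erase w) then
        x v * vsign R σ v * (x w * vsign R (insert v σ) w) else 0 := by
    intro v hv
    rw [Finset.mem_compl] at hv
    rw [coef, Finset.sum_insert hv, mul_add, Finset.mul_sum, Finset.erase_insert hv,
      vsign_insert_self]
    congr 1
    · simp only [eq_comm (a := σ') (b := σ)]
      split_ifs
      · linear_combination x v ^ 2 * vsign_mul_self (R := R) σ v
      · simp
    · refine Finset.sum_congr rfl fun w hw => ?_
      rw [Finset.erase_insert_of_ne (by rintro rfl; exact hv hw)]
      simp
  have h2 : ∀ w ∈ σ, x w * vsign R σ w * coef x (σ.erase w) σ' =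
      (if σ = σ' then x w ^ 2 else 0) -
      ∑ v ∈ σᶜ, if σ' = insert v (σ.erase w) then
        x v * vsign R σ v * (x w * vsign R (insert v σ) w) else 0 := by
    intro w hw
    have h3 : coef x (σ.erase w) σ' = ∑ τ, coef x (σ.erase w) τ * if τ = σ' then 1 else 0 := by
      simp
    rw [h3, sum_coef_mul_right, Finset.compl_erase, Finset.sum_insert (by simpa using hw),
      Finset.insert_erase hw, vsign_erase_self, mul_add, sub_eq_add_neg, Finset.mul_sum,
      ← Finset.sum_neg_distrib]
    congr 1
    · split_ifs
      · linear_combination x w ^ 2 * vsign_mul_self (R := R) σ w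
      · simp
    · refine Finset.sum_congr rfl fun v hv => ?_
      rw [Finset.mem_compl] at hv
      simp only [eq_comm (a := σ')]
      have hvw : v ≠ w := by rintro rfl; exact hv hw
      split_ifs
      · rw [vsign_insert hv w, vsign_eq_erase hw v]
        rcases lt_or_gt_of_ne hvw with h' | h' <;> simp [h', h'.not_gt] <;> ring
      · simp
  rw [Finset.sum_congr rfl h1, Finset.sum_congr rfl h2, Finset.sum_add_distrib,
    Finset.sum_sub_distrib, Finset.sum_comm (s := σᶜ) (t := σ)]
  split_ifs with h
  · rw [← Finset.sum_compl_add_sum σ fun v => x v ^ 2]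
    ring
  · simp

end Coef

/-! ### The determinant of one plus a weighted down-Laplacian. -/

section Det

variable {V : Type*} [LinearOrder V] [Fintype V]

/-- The weighted boundary matrix from `j + 1`-subsets to `j`-subsets of `U`. -/
def wmat (x : V → ℝ) (U : Finset V) (j : ℕ) :
    Matrix (U.powersetCard j) (U.powersetCard (j + 1)) ℝ :=
  fun σ τ => coef x σ.1 τ.1

/-- The weighted down-Laplacian on the `j`-subsets of `U`. -/
def downLap (x : V → ℝ) (U : Finset V) (j : ℕ) :
    Matrix (U.powersetCard j) (U.powersetCard j) ℝ :=
  fun σ τ => ∑ ρ, coef x ρ σ.1 * coef x ρ τ.1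

open Matrix

theorem downLap_zero (x : V → ℝ) (U : Finset V) : downLap x U 0 = 0 := by
  ext ⟨σ, hσ⟩ τ
  simp only [Finset.powersetCard_zero, Finset.mem_singleton] at hσ
  subst hσ
  simp [downLap, coef]

theorem downLap_succ (x : V → ℝ) (U : Finset V) (j : ℕ) :
    downLap x U (j + 1) = (wmat x U j)ᵀ * wmat x U j := by
  ext σ τ
  simp only [downLap, wmat, mul_apply, transpose_apply]
  rw [Finset.sum_coe_sort (U.powersetCard j) fun ρ => coef x ρ σ.1 * coef x ρ τ.1]
  symm
  refine Finset.sum_subset (Finset.subset_univ _) fun ρ _ hρ => ?_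
  have hσ := Finset.mem_powersetCard.1 σ.2
  by_cases h : ρ ⊆ σ.1
  · rw [coef_eq_zero_of_card, zero_mul]
    intro h'
    exact hρ (Finset.mem_powersetCard.2 ⟨h.trans hσ.1, by omega⟩)
  · rw [coef_eq_zero_of_not_subset x h, zero_mul]

theorem wmat_mul_transpose_add_downLap {x : V → ℝ} {U : Finset V} (hx : ∀ v ∉ U, x v = 0)
    (j : ℕ) : wmat x U j * (wmat x U j)ᵀ + downLap x U j = (∑ v, x v ^ 2) • 1 := by
  ext σ τ
  have h := sum_coef_clifford x σ.1 τ.1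
  simp only [downLap, wmat, Matrix.add_apply, mul_apply, transpose_apply, Matrix.smul_apply, one_apply,
    smul_eq_mul, mul_ite, mul_one, mul_zero, Subtype.ext_iff]
  rw [← h, Finset.sum_coe_sort (U.powersetCard (j + 1)) fun ρ => coef x σ.1 ρ * coef x τ.1 ρ]
  congr 1
  refine Finset.sum_subset (Finset.subset_univ _) fun ρ _ hρ => ?_
  have hσ := Finset.mem_powersetCard.1 σ.2
  have : coef x σ.1 ρ = 0 := by
    refine Finset.sum_eq_zero fun v hv => ?_
    split_ifs with h
    · rw [hx v, zero_mul]
      intro hvU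
      refine hρ (Finset.mem_powersetCard.2 ⟨?_, ?_⟩)
      · rw [← Finset.insert_erase hv, ← h]
        exact Finset.insert_subset hvU hσ.1
      · rw [← Finset.card_erase_add_one hv, ← h, hσ.2]
    · rfl
  rw [this, zero_mul]

theorem downLap_mul_self (x : V → ℝ) (U : Finset V) (j : ℕ) :
    wmat x U j * (wmat x U j)ᵀ * downLap x U j = 0 := by
  cases j with
  | zero => simp [downLap_zero]
  | succ j =>
    have : wmat x U j * wmat x U (j + 1) = 0 := by
      ext σ τ
      rw [mul_apply, Matrix.zero_apply, ← sum_coef_mul_coef_eq_zero x σ.1 τ.1]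
      simp only [wmat]
      rw [Finset.sum_coe_sort (U.powersetCard (j + 1)) fun ρ => coef x σ.1 ρ * coef x ρ τ.1]
      refine Finset.sum_subset (Finset.subset_univ _) fun ρ _ hρ => ?_
      have hτ := Finset.mem_powersetCard.1 τ.2
      by_cases h : ρ ⊆ τ.1
      · rw [coef_eq_zero_of_card (τ := τ.1), mul_zero]
        intro h'
        exact hρ (Finset.mem_powersetCard.2 ⟨h.trans hτ.1, by omega⟩)
      · rw [coef_eq_zero_of_not_subset x h, mul_zero]
    rw [downLap_succ, Matrix.mul_assoc, ← Matrix.mul_assoc _ _ (wmat x U j), ← transpose_mul,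
      this]
    simp

/-- With `M = wmat x U j` and `L = downLap x U j`, `det (1 + MᵀM) = det (1 + MMᵀ)`. Since `MMᵀL =
0`, `(1 + MMᵀ)(1 + L) = 1 + MMᵀ + L` is scalar. -/
theorem det_one_add_downLap_succ {x : V → ℝ} {U : Finset V} (hx : ∀ v ∉ U, x v = 0) (j : ℕ) :
    (1 + downLap x U (j + 1)).det * (1 + downLap x U j).det =
      (1 + ∑ v, x v ^ 2) ^ U.card.choose j := by
  rw [downLap_succ, det_one_add_mul_comm, ← det_mul, add_mul, one_mul, mul_add, mul_one,
    downLap_mul_self, add_zero, add_assoc, add_comm (downLap x U j),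
    wmat_mul_transpose_add_downLap hx]
  have : (1 : Matrix (U.powersetCard j) (U.powersetCard j) ℝ) + (∑ v, x v ^ 2) • 1 =
      (1 + ∑ v, x v ^ 2) • 1 := by rw [add_smul, one_smul]
  rw [this, det_smul, det_one, mul_one, Fintype.card_coe, Finset.card_powersetCard]

/-- Consecutive exponents add up to `U.card.choose j`, a recursion solved by Pascal's rule. The `+
1` accounts for the vertex left out of `U` in the application. -/
theorem det_one_add_downLap {x : V → ℝ} {U : Finset V} (hx : ∀ v ∉ U, x v = 0) (j : ℕ) :
    (1 + downLap x U j).det = (1 + ∑ v, x v ^ 2) ^ m₁ (U.card + 1) j := by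
  have hpos : 0 < 1 + ∑ v, x v ^ 2 := by positivity
  induction j with
  | zero => simp [downLap_zero, m₁]
  | succ j ih =>
    have h := det_one_add_downLap_succ hx j
    rw [ih] at h
    refine mul_right_cancel₀ (pow_ne_zero _ hpos.ne') (h.trans ?_)
    rw [← pow_add]
    -- For empty `U` the exponent identity can fail under truncated subtraction, but the base is
    -- then `1`.
    rcases Nat.eq_zero_or_pos U.card with h0 | h0
    · have : ∀ v, x v = 0 := fun v => hx v (by simp [Finset.card_eq_zero.1 h0])
      simp [this]
    · congr 1
      obtain ⟨m, hm⟩ : ∃ m, U.card = m + 1 := ⟨U.card - 1, by omega⟩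
      rw [hm]
      cases j with
      | zero => simp [m₁]
      | succ j =>
        have : m + 1 + 1 - 2 = m := rfl
        simp only [m₁, this, Nat.choose_succ_succ]
        exact add_comm _ _

end Det

end QAcyclic

/-! ### Hadamard's inequality and the Gram determinant. -/

namespace QAcyclic

open Finset Matrix

/-- **Hadamard's inequality** for positive semidefinite matrices. -/
theorem det_le_prod_diag {ι : Type*} [Fintype ι] [DecidableEq ι] {G : Matrix ι ι ℝ}
    (hG : G.PosSemidef) : G.det ≤ ∏ i, G i i := by
  have hdiag : ∀ i, 0 ≤ G i i := fun i => hG.diag_nonneg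
  by_cases h0 : G.det = 0
  · rw [h0]; exact Finset.prod_nonneg fun i _ => hdiag i
  have hpd : G.PosDef := (hG.posDef_iff_det_ne_zero).2 h0
  have hpos : ∀ i, 0 < G i i := fun i => hpd.diag_pos
  -- Rescale to unit diagonal; the eigenvalues then sum to the size of the matrix, and `λ ≤ exp (λ -
  -- 1)` bounds their product by `1`.
  set D : Matrix ι ι ℝ := diagonal fun i => (√(G i i))⁻¹ with hD
  have hDH : Dᴴ = D := by rw [hD, diagonal_conjTranspose]; congr
  have hN : (D * G * D).PosSemidef := by
    have := hG.conjTranspose_mul_mul_same D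
    rwa [hDH] at this
  have hdet : (D * G * D).det = G.det * (∏ i, G i i)⁻¹ := by
    rw [det_mul, det_mul, hD, det_diagonal, ← Finset.prod_inv_distrib, mul_comm _ G.det, mul_assoc,
      ← Finset.prod_mul_distrib]
    congr 1
    refine Finset.prod_congr rfl fun i _ => ?_
    rw [← mul_inv, Real.mul_self_sqrt (hdiag i)]
  have htr : (D * G * D).trace = Fintype.card ι := by
    simp only [trace, diag_apply, hD, mul_diagonal, diagonal_mul]
    rw [Finset.sum_congr rfl (g := fun _ => (1 : ℝ))]
    · simp
    · intro i _
      rw [mul_comm, ← mul_assoc, ← mul_inv, Real.mul_self_sqrt (hdiag i),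
        inv_mul_cancel₀ (hpos i).ne']
  have hle : (D * G * D).det ≤ 1 := by
    rw [hN.isHermitian.det_eq_prod_eigenvalues]
    have htr' := hN.isHermitian.trace_eq_sum_eigenvalues
    rw [htr] at htr'
    simp only [RCLike.ofReal_real_eq_id, id_eq] at htr' ⊢
    calc ∏ i, hN.isHermitian.eigenvalues i
        ≤ ∏ i, Real.exp (hN.isHermitian.eigenvalues i - 1) :=
          Finset.prod_le_prod (fun i _ => hN.eigenvalues_nonneg i) fun i _ => by
            linarith [Real.add_one_le_exp (hN.isHermitian.eigenvalues i - 1)]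
      _ = 1 := by
          rw [← Real.exp_sum, Finset.sum_sub_distrib, ← htr']
          simp
  rw [hdet, ← div_eq_mul_inv, div_le_one (Finset.prod_pos fun i _ => hpos i)] at hle
  exact hle

section Gram

variable {V : Type*} [LinearOrder V] [Fintype V]

/-- The Gram matrix of the weighted boundaries of the members of `F`. -/
def gram (x : V → ℝ) (F : Finset (Finset V)) : Matrix F F ℝ :=
  fun τ τ' => ∑ σ, coef x σ τ.1 * coef x σ τ'.1

theorem gram_posSemidef (x : V → ℝ) (F : Finset (Finset V)) : (gram x F).PosSemidef := by
  have : gram x F = (Matrix.of fun (σ : Finset V) (τ : F) => coef x σ τ.1)ᴴ *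
      Matrix.of fun (σ : Finset V) (τ : F) => coef x σ τ.1 := by
    ext τ τ'
    simp [gram, mul_apply]
  rw [this]
  exact posSemidef_conjTranspose_mul_self _

theorem det_gram_le (x : V → ℝ) (F : Finset (Finset V)) :
    (gram x F).det ≤ ∏ τ ∈ F, ∑ i ∈ τ, x i ^ 2 := by
  refine (det_le_prod_diag (gram_posSemidef x F)).trans_eq ?_
  rw [← Finset.prod_coe_sort F fun τ => ∑ i ∈ τ, x i ^ 2]
  exact Finset.prod_congr rfl fun τ _ => sum_coef_mul_coef_self x τ.1

/-- The boundary matrix from `F` to the `k`-subsets that avoid `v`. -/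
def redMat {R : Type*} [CommRing R] (x : V → R) (F : Finset (Finset V)) (v : V) (k : ℕ) :
    Matrix ((univ.erase v).powersetCard k) F R :=
  fun σ τ => coef x σ.1 τ.1

/-- In `∂∂ = 0` at `(η, τ)`, the only intermediate set through `v` that contributes is `insert v η`;
solve for its term. -/
theorem coef_insert_mul (x : V → ℝ) {v : V} (hxv : x v ≠ 0) {η : Finset V} (hη : v ∉ η)
    (τ : Finset V) : coef x (insert v η) τ =
      -(vsign ℝ η v * (x v)⁻¹ * ∑ σ with v ∉ σ, coef x η σ * coef x σ τ) := by
  have h := sum_coef_mul_coef_eq_zero x η τ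
  rw [← Finset.sum_filter_add_sum_filter_not univ (fun σ => v ∉ σ)] at h
  have h2 : ∑ σ with ¬ v ∉ σ, coef x η σ * coef x σ τ =
      coef x η (insert v η) * coef x (insert v η) τ := by
    refine Finset.sum_eq_single_of_mem (insert v η) (by simp) fun σ hσ hne => ?_
    rw [Finset.mem_filter, not_not] at hσ
    have : coef x η σ = 0 := by
      refine Finset.sum_eq_zero fun w hw => if_neg ?_
      rintro rfl
      have : w = v := by
        by_contra hwv
        exact hη (by simp [hσ.2, Ne.symm hwv])
      subst this
      exact hne (Finset.insert_erase hw).symm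
    rw [this, zero_mul]
  rw [h2, coef_insert x hη] at h
  have h3 := vsign_mul_self (R := ℝ) η v
  have : ∑ σ with v ∉ σ, coef x η σ * coef x σ τ =
    -(x v * vsign ℝ η v * coef x (insert v η) τ) := by linarith
  rw [this]
  field_simp
  linear_combination (-coef x (insert v η) τ) * h3

theorem mem_powersetCard_erase {v : V} {σ : Finset V} {k : ℕ} :
    σ ∈ (univ.erase v).powersetCard k ↔ v ∉ σ ∧ σ.card = k := by
  simp [Finset.mem_powersetCard, Finset.subset_erase]

theorem gram_eq {x : V → ℝ} {v : V} (hxv : x v ≠ 0) {F : Finset (Finset V)} {k : ℕ}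
    (hF : ∀ τ ∈ F, τ.card = k + 1) :
    gram x F = (redMat x F v k)ᵀ *
      (1 + downLap (fun u => if u = v then 0 else (x v)⁻¹ * x u) (univ.erase v) k) *
        redMat x F v k := by
  set y : V → ℝ := fun u => if u = v then 0 else (x v)⁻¹ * x u with hy
  have hsum : ∀ (τ : F) (G : Finset V → ℝ),
      ∑ σ with v ∉ σ, G σ * coef x σ τ.1 =
        ∑ σ : (univ.erase v).powersetCard k, G σ.1 * coef x σ.1 τ.1 := by
    intro τ G
    rw [Finset.sum_coe_sort ((univ.erase v).powersetCard k) fun σ => G σ * coef x σ τ.1]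
    symm
    refine Finset.sum_subset (fun σ hσ => by simp [(mem_powersetCard_erase.1 hσ).1]) fun σ hσ hσ' => ?_
    rw [Finset.mem_filter] at hσ
    rw [coef_eq_zero_of_card, mul_zero]
    rw [hF τ.1 τ.2]
    exact fun h => hσ' (mem_powersetCard_erase.2 ⟨hσ.2, by omega⟩)
  have hy' : ∀ η σ : Finset V, v ∉ σ → coef y η σ = (x v)⁻¹ * coef x η σ := by
    intro η σ hσ
    rw [← coef_smul]
    refine coef_congr fun u hu => ?_
    simp only [hy]
    rw [if_neg (by rintro rfl; exact hσ hu)]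
  -- Rows avoiding `v` give the identity part, rows through `v` the Laplacian part; in the latter
  -- sum, sets `η` containing `v` contribute zero.
  have hgram : ∀ τ τ' : F, gram x F τ τ' =
      ∑ σ with v ∉ σ, coef x σ τ.1 * coef x σ τ'.1 +
      ∑ η : Finset V, (∑ σ : (univ.erase v).powersetCard k, coef y η σ.1 * coef x σ.1 τ.1) *
        (∑ σ : (univ.erase v).powersetCard k, coef y η σ.1 * coef x σ.1 τ'.1) := by
    intro τ τ'
    rw [gram, ← Finset.sum_filter_add_sum_filter_not univ (fun σ => v ∉ σ)]
    congr 1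
    have hins : ∑ σ with ¬ v ∉ σ, coef x σ τ.1 * coef x σ τ'.1 =
        ∑ η with v ∉ η, coef x (insert v η) τ.1 * coef x (insert v η) τ'.1 := by
      refine Finset.sum_nbij' (fun σ => σ.erase v) (fun η => insert v η) ?_ ?_ ?_ ?_ ?_
      · simp
      · simp
      · intro σ hσ
        simp only [Finset.mem_filter, not_not] at hσ
        exact Finset.insert_erase hσ.2
      · intro σ hσ
        simp only [Finset.mem_filter] at hσ
        exact Finset.erase_insert hσ.2
      · intro σ hσ
        simp only [Finset.mem_filter, not_not] at hσ
        rw [Finset.insert_erase hσ.2]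
    rw [hins]
    have hz : ∀ η : Finset V, ¬ v ∉ η → ∀ τ : F,
        ∑ σ : (univ.erase v).powersetCard k, coef y η σ.1 * coef x σ.1 τ.1 = 0 := by
      intro η hη τ
      refine Finset.sum_eq_zero fun σ _ => ?_
      have hσ := mem_powersetCard_erase.1 σ.2
      rw [coef_eq_zero_of_not_subset y, zero_mul]
      exact fun h => hη fun hv => hσ.1 (h hv)
    rw [← Finset.sum_filter_add_sum_filter_not univ (fun σ => v ∉ σ) (fun η =>
      (∑ σ : (univ.erase v).powersetCard k, coef y η σ.1 * coef x σ.1 τ.1) *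
        (∑ σ : (univ.erase v).powersetCard k, coef y η σ.1 * coef x σ.1 τ'.1))]
    rw [Finset.sum_eq_zero (s := {η : Finset V | ¬ v ∉ η}), add_zero]
    · refine Finset.sum_congr rfl fun η hη => ?_
      rw [Finset.mem_filter] at hη
      rw [coef_insert_mul x hxv hη.2, coef_insert_mul x hxv hη.2, hsum, hsum]
      have h1 : ∀ τ : F, ∑ σ : (univ.erase v).powersetCard k, coef y η σ.1 * coef x σ.1 τ.1 =
          (x v)⁻¹ * ∑ σ : (univ.erase v).powersetCard k, coef x η σ.1 * coef x σ.1 τ.1 := by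
        intro τ
        rw [Finset.mul_sum]
        refine Finset.sum_congr rfl fun σ _ => ?_
        rw [hy' η σ.1 (mem_powersetCard_erase.1 σ.2).1, mul_assoc]
      rw [h1, h1]
      have h3 := vsign_mul_self (R := ℝ) η v
      generalize ∑ σ : (univ.erase v).powersetCard k, coef x η σ.1 * coef x σ.1 τ.1 = a
      generalize ∑ σ : (univ.erase v).powersetCard k, coef x η σ.1 * coef x σ.1 τ'.1 = b
      linear_combination ((x v)⁻¹ * a * ((x v)⁻¹ * b)) * h3
    · intro η hη
      rw [Finset.mem_filter] at hη
      rw [hz η hη.2, zero_mul]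
  have hY : downLap y (univ.erase v) k =
      (Matrix.of fun (η : Finset V) (σ : (univ.erase v).powersetCard k) => coef y η σ.1)ᵀ *
        Matrix.of fun (η : Finset V) (σ : (univ.erase v).powersetCard k) => coef y η σ.1 := by
    ext σ σ'
    simp [downLap, mul_apply]
  ext τ τ'
  rw [hgram, hsum, hY, Matrix.mul_add, Matrix.add_mul, Matrix.mul_one, Matrix.add_apply,
    ← Matrix.mul_assoc, ← transpose_mul, Matrix.mul_assoc]
  simp only [mul_apply, transpose_apply, redMat, of_apply]

/-- Each `i ≠ v` lies in `m₁` of the `k`-sets avoiding `v`; the extra power of `f v` restores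
symmetry. -/
theorem prod_prod_powersetCard_erase {v : V} (k : ℕ) (f : V → ℝ) :
    (∏ σ : (univ.erase v).powersetCard k, ∏ i ∈ σ.1, f i) * f v ^ m₁ (Fintype.card V) k =
      ∏ i, f i ^ m₁ (Fintype.card V) k := by
  rw [← Finset.prod_erase_mul univ _ (Finset.mem_univ v),
    Finset.prod_coe_sort ((univ.erase v).powersetCard k) fun σ => ∏ i ∈ σ, f i]
  congr 1
  have : ∏ σ ∈ (univ.erase v).powersetCard k, ∏ i ∈ σ, f i =
      ∏ i ∈ univ.erase v, ∏ _σ ∈ (univ.erase v).powersetCard k with i ∈ _σ, f i := by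
    refine Finset.prod_comm' fun σ i => ?_
    simp only [Finset.mem_filter, Finset.mem_powersetCard]
    exact ⟨fun h => ⟨⟨h.1, h.2⟩, h.1.1 h.2⟩, fun h => h.1⟩
  rw [this]
  refine Finset.prod_congr rfl fun i hi => ?_
  rw [Finset.prod_const]
  congr 1
  cases k with
  | zero =>
    rw [Finset.powersetCard_zero, m₁, Finset.card_eq_zero, Finset.filter_eq_empty_iff]
    simp
  | succ k =>
    have hcard : ((univ.erase v).erase i).card = Fintype.card V - 2 := by
      rw [Finset.card_erase_of_mem hi, Finset.card_erase_of_mem (Finset.mem_univ v),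
        Finset.card_univ, Nat.sub_sub]
    rw [m₁, ← hcard, ← Finset.card_powersetCard]
    refine Finset.card_nbij' (fun σ => σ.erase i) (fun σ => insert i σ) ?_ ?_ ?_ ?_
    · intro σ hσ
      simp only [Finset.coe_filter, Set.mem_ofPred_eq, Finset.mem_powersetCard, Finset.mem_coe]
        at hσ ⊢
      refine ⟨Finset.erase_subset_erase _ hσ.1.1, ?_⟩
      rw [Finset.card_erase_of_mem hσ.2, hσ.1.2, Nat.add_sub_cancel]
    · intro σ hσ
      simp only [Finset.coe_filter, Set.mem_ofPred_eq, Finset.mem_powersetCard, Finset.mem_coe]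
        at hσ ⊢
      have hiσ : i ∉ σ := fun h => by simpa using hσ.1 h
      refine ⟨⟨Finset.insert_subset hi (hσ.1.trans (Finset.erase_subset _ _)), ?_⟩, by simp⟩
      rw [Finset.card_insert_of_notMem hiσ, hσ.2]
    · intro σ hσ
      simp only [Finset.coe_filter, Set.mem_ofPred_eq] at hσ
      exact Finset.insert_erase hσ.2
    · intro σ hσ
      simp only [Finset.mem_powersetCard, Finset.mem_coe] at hσ
      exact Finset.erase_insert fun h => by simpa using hσ.1 h

theorem prod_prod_eq_prod_pow (F : Finset (Finset V)) (f : V → ℝ) :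
    ∏ τ ∈ F, ∏ i ∈ τ, f i = ∏ i, f i ^ (F.filter fun τ => i ∈ τ).card := by
  have : ∏ τ ∈ F, ∏ i ∈ τ, f i = ∏ i, ∏ _τ ∈ F with i ∈ _τ, f i := by
    refine Finset.prod_comm' fun σ i => ?_
    simp
  simp [this]

theorem det_gram_mul {x : V → ℝ} (hx : ∀ i, x i ≠ 0) {F : Finset (Finset V)} {k : ℕ} {v : V}
    (hF : ∀ τ ∈ F, τ.card = k + 1) (e : (univ.erase v).powersetCard k ≃ F) :
    (gram x F).det * ∏ i, (x i ^ 2) ^ m₁ (Fintype.card V) k =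
      ((redMat (fun _ => (1 : ℝ)) F v k).submatrix id e).det ^ 2 *
        (∏ i, (x i ^ 2) ^ (F.filter fun τ => i ∈ τ).card) *
          (∑ i, x i ^ 2) ^ m₁ (Fintype.card V) k := by
  set A := (redMat (fun _ => (1 : ℝ)) F v k).submatrix id e with hA
  set B := (redMat x F v k).submatrix id e with hB
  set y : V → ℝ := fun u => if u = v then 0 else (x v)⁻¹ * x u with hy
  have h1 : (gram x F).det =
      B.det ^ 2 * (1 + downLap y (univ.erase v) k).det := by
    rw [← det_submatrix_equiv_self e, gram_eq (hx v) hF,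
      ← submatrix_mul_equiv _ _ _ (Equiv.refl _) _,
      ← submatrix_mul_equiv _ _ _ (Equiv.refl _) _, det_mul, det_mul]
    have : ((redMat x F v k)ᵀ.submatrix e (Equiv.refl _)) = Bᵀ := rfl
    rw [this, det_transpose]
    have : ((redMat x F v k).submatrix (Equiv.refl _) e) = B := rfl
    rw [this, Equiv.coe_refl, submatrix_id_id]
    ring
  have h2 : B.det * ∏ σ : (univ.erase v).powersetCard k, ∏ i ∈ σ.1, x i =
      A.det * ∏ τ ∈ F, ∏ i ∈ τ, x i := by
    have hp : ∏ τ ∈ F, ∏ i ∈ τ, x i = ∏ σ, ∏ i ∈ (e σ).1, x i := by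
      rw [← Finset.prod_coe_sort F fun τ => ∏ i ∈ τ, x i]
      exact (Equiv.prod_comp e fun τ => ∏ i ∈ τ.1, x i).symm
    rw [hp, mul_comm, ← det_diagonal, ← det_diagonal, ← det_mul, ← det_mul]
    congr 1
    ext σ ρ
    rw [diagonal_mul, mul_diagonal, mul_comm]
    exact coef_mul_prod x σ.1 (e ρ).1
  have h3 : (1 + downLap y (univ.erase v) k).det * (x v ^ 2) ^ m₁ (Fintype.card V) k =
      (∑ i, x i ^ 2) ^ m₁ (Fintype.card V) k := by
    have hcard : (univ.erase v : Finset V).card + 1 = Fintype.card V := by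
      rw [Finset.card_erase_add_one (Finset.mem_univ v), Finset.card_univ]
    rw [det_one_add_downLap, hcard, ← mul_pow]
    · congr 1
      rw [← Finset.sum_erase_add univ _ (Finset.mem_univ v),
        ← Finset.sum_erase_add univ (fun i => x i ^ 2) (Finset.mem_univ v)]
      have : ∑ i ∈ univ.erase v, y i ^ 2 = (x v ^ 2)⁻¹ * ∑ i ∈ univ.erase v, x i ^ 2 := by
        rw [Finset.mul_sum]
        refine Finset.sum_congr rfl fun i hi => ?_
        simp only [hy, if_neg (Finset.ne_of_mem_erase hi)]
        rw [mul_pow, inv_pow]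
      have hv := hx v
      rw [this, show y v = 0 by simp [hy]]
      field_simp
      ring
    · intro u hu
      have : u = v := by simpa using hu
      simp [hy, this]
  rw [← prod_prod_powersetCard_erase (v := v), ← prod_prod_eq_prod_pow, h1, ← h3]
  simp only [Finset.prod_pow]
  -- `h2` enters squared, as a difference of squares.
  linear_combination ((1 + downLap y (univ.erase v) k).det * (x v ^ 2) ^ m₁ (Fintype.card V) k) *
    (B.det * ∏ σ : (univ.erase v).powersetCard k, ∏ i ∈ σ.1, x i +
      A.det * ∏ τ ∈ F, ∏ i ∈ τ, x i) * h2

end Gram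

end QAcyclic

/-! ### Integral homology as the cokernel of the reduced boundary matrix. -/

namespace QAcyclic

open Finset Matrix

/-- The cokernel of an integer matrix with nonzero determinant is finite, and its order is the
absolute value of the determinant. -/
theorem card_quotient_range_mulVecLin {ι : Type*} [Fintype ι] [DecidableEq ι] {A : Matrix ι ι ℤ}
    (hA : A.det ≠ 0) :
    Nat.card ((ι → ℤ) ⧸ LinearMap.range A.mulVecLin) = A.det.natAbs := by
  have hinj : Function.Injective A.mulVecLin := by
    rw [← LinearMap.ker_eq_bot]
    refine (Submodule.eq_bot_iff _).2 fun w hw => ?_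
    by_contra hne
    exact hA (Matrix.exists_mulVec_eq_zero_iff.1 ⟨w, hne, by simpa using hw⟩)
  rw [← Submodule.natAbs_det_equiv (LinearMap.range A.mulVecLin)
    (LinearEquiv.ofInjective A.mulVecLin hinj)]
  congr 1
  rw [← LinearMap.det_toLin']
  congr 1

variable {n k : ℕ} {T : PreAbstractSimplicialComplex (Fin n)}

theorem boundaryMatrix_apply (R : Type) [CommRing R] (j : ℕ) (σ : Face T j)
    (τ : Face T (j + 1)) : boundaryMatrix R T j σ τ = coef (fun _ => (1 : R)) σ.1 τ.1 := by
  simp only [boundaryMatrix, coef, vsign, one_mul]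

theorem boundary_apply (R : Type) [CommRing R] (j : ℕ) (w : Face T (j + 1) → R) (σ : Face T j) :
    boundary R T j w σ = ∑ τ, coef (fun _ => (1 : R)) σ.1 τ.1 * w τ := by
  simp only [boundary, mulVecLin_apply, mulVec, dotProduct, boundaryMatrix_apply]

theorem IsQAcyclic.mem_face (hT : IsQAcyclic T k) {j : ℕ} (hj : j ≤ k) {σ : Finset (Fin n)}
    (hσ : σ.card = j) : (σ = ∅ ∨ σ ∈ T.faces) ∧ σ.card = j := by
  refine ⟨?_, hσ⟩
  rcases σ.eq_empty_or_nonempty with h | h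
  · exact Or.inl h
  · exact Or.inr (hT.full_skeleton σ h (hσ.trans_le hj))

theorem IsQAcyclic.sum_face (hT : IsQAcyclic T k) {R : Type} [CommRing R]
    {G : Finset (Fin n) → R} (hG : ∀ σ, σ.card ≠ k → G σ = 0) :
    ∑ σ : Face T k, G σ.1 = ∑ σ, G σ := by
  classical
  rw [← Finset.sum_subset (Finset.subset_univ (univ.filter fun σ => σ.card = k))
    fun σ _ hσ => hG σ (by simpa using hσ)]
  exact (Finset.sum_subtype _ (fun σ =>
    ⟨fun h => hT.mem_face le_rfl (by simpa using h), fun h => by simpa using h.2⟩) G).symm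

/-- Testing against all sets `η`, not just faces, treats `k = 0` and `k > 0` uniformly. -/
theorem IsQAcyclic.mem_cycles_iff (hT : IsQAcyclic T k) {R : Type} [CommRing R]
    {z : Face T k → R} :
    z ∈ cycles R T k ↔ ∀ η : Finset (Fin n), ∑ σ, coef (fun _ => (1 : R)) η σ.1 * z σ = 0 := by
  cases k with
  | zero =>
    refine ⟨fun _ η => Finset.sum_eq_zero fun σ _ => ?_, fun _ => Submodule.mem_top⟩
    rw [coef_eq_zero_of_card, zero_mul]
    rw [σ.2.2]
    omega
  | succ k =>
    rw [cycles, LinearMap.mem_ker, funext_iff]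
    simp only [boundary_apply, Pi.zero_apply]
    refine ⟨fun h η => ?_, fun h η => h η.1⟩
    by_cases hη : η.card = k
    · exact h ⟨η, hT.mem_face k.le_succ hη⟩
    · refine Finset.sum_eq_zero fun σ _ => ?_
      rw [coef_eq_zero_of_card, zero_mul]
      rw [σ.2.2]
      omega

theorem IsQAcyclic.boundary_mem_cycles (hT : IsQAcyclic T k) {R : Type} [CommRing R]
    [NoZeroDivisors R] [CharZero R] (w : Face T (k + 1) → R) :
    boundary R T k w ∈ cycles R T k := by
  rw [hT.mem_cycles_iff]
  intro η
  simp only [boundary_apply, Finset.mul_sum]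
  rw [Finset.sum_comm]
  refine Finset.sum_eq_zero fun τ _ => ?_
  simp only [← mul_assoc]
  rw [← Finset.sum_mul, hT.sum_face (G := fun σ => coef (fun _ => (1 : R)) η σ *
    coef (fun _ => (1 : R)) σ τ.1), sum_coef_mul_coef_eq_zero, zero_mul]
  intro σ hσ
  rw [coef_eq_zero_of_card (τ := τ.1), mul_zero]
  rw [τ.2.2]
  omega

/-- Restriction of chains to the faces that avoid `v`. -/
def restrict (hT : IsQAcyclic T k) (R : Type) [CommRing R] (v : Fin n) :
    (Face T k → R) →ₗ[R] ((univ.erase v).powersetCard k → R) :=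
  LinearMap.funLeft R R fun σ => ⟨σ.1, hT.mem_face le_rfl (Finset.mem_powersetCard.1 σ.2).2⟩

theorem restrict_apply (hT : IsQAcyclic T k) (R : Type) [CommRing R] (v : Fin n)
    (z : Face T k → R) (σ : (univ.erase v).powersetCard k) :
    restrict hT R v z σ = z ⟨σ.1, hT.mem_face le_rfl (Finset.mem_powersetCard.1 σ.2).2⟩ := rfl

/-- For `σ` through `v`, the cycle condition at `σ.erase v` involves no other face through `v`, so
it isolates `z σ`. -/
theorem IsQAcyclic.eq_zero_of_restrict_eq_zero (hT : IsQAcyclic T k) {R : Type} [CommRing R]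
    {v : Fin n} {z : Face T k → R} (hz : z ∈ cycles R T k) (hr : restrict hT R v z = 0) :
    z = 0 := by
  have h0 : ∀ σ : Face T k, v ∉ σ.1 → z σ = 0 := fun σ hσ =>
    congrFun hr ⟨σ.1, mem_powersetCard_erase.2 ⟨hσ, σ.2.2⟩⟩
  ext σ
  by_cases hσ : v ∈ σ.1
  · have h := hT.mem_cycles_iff.1 hz (σ.1.erase v)
    rw [Finset.sum_eq_single σ, coef_erase _ hσ, one_mul] at h
    · have := congrArg (vsign R σ.1 v * ·) h
      simpa [← mul_assoc, vsign_mul_self] using this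
    · intro ρ _ hρ
      by_cases hv : v ∈ ρ.1
      · have : coef (fun _ => (1 : R)) (σ.1.erase v) ρ.1 = 0 := by
          refine Finset.sum_eq_zero fun w hw => if_neg fun h => ?_
          have hwv : w = v := by
            by_contra hwv
            have : v ∈ ρ.1.erase w := by simp [hv, Ne.symm hwv]
            rw [← h] at this
            simp at this
          subst hwv
          have := congrArg (insert w) h
          rw [Finset.insert_erase hσ, Finset.insert_erase hw] at this
          exact hρ (Subtype.ext this.symm)
        rw [this, zero_mul]
      · rw [h0 ρ hv, mul_zero]
    · simp
  · exact h0 σ hσ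

theorem IsQAcyclic.exists_cycle_restrict_eq (hT : IsQAcyclic T k) {R : Type} [CommRing R]
    [NoZeroDivisors R] [CharZero R] (v : Fin n) (a : (univ.erase v).powersetCard k → R) :
    ∃ z ∈ cycles R T k, restrict hT R v z = a := by
  -- The boundary of the cone from `v` over `a`, with signs correcting the orientation. The cone's
  -- simplices need not be faces of `T`; its boundary lives on the full skeleton.
  refine ⟨fun σ => ∑ ρ, coef (fun _ => (1 : R)) σ.1 (insert v ρ.1) * (vsign R ρ.1 v * a ρ),
    ?_, ?_⟩
  · rw [hT.mem_cycles_iff]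
    intro η
    simp only [Finset.mul_sum]
    rw [Finset.sum_comm]
    refine Finset.sum_eq_zero fun ρ _ => ?_
    have hρ := mem_powersetCard_erase.1 ρ.2
    simp only [← mul_assoc]
    rw [← Finset.sum_mul, ← Finset.sum_mul,
      hT.sum_face (G := fun σ => coef (fun _ => (1 : R)) η σ *
        coef (fun _ => (1 : R)) σ (insert v ρ.1)), sum_coef_mul_coef_eq_zero, zero_mul, zero_mul]
    intro σ hσ
    rw [coef_eq_zero_of_card (σ := σ), mul_zero]
    rw [Finset.card_insert_of_notMem hρ.1, hρ.2]
    omega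
  · ext σ
    have hσ := mem_powersetCard_erase.1 σ.2
    rw [restrict_apply, Finset.sum_eq_single σ, coef_insert _ hσ.1, one_mul, ← mul_assoc,
      vsign_mul_self, one_mul]
    · intro ρ _ hρ
      have hρv := mem_powersetCard_erase.1 ρ.2
      rw [coef_eq_zero_of_not_subset, zero_mul]
      intro h
      refine hρ (Subtype.ext (Finset.eq_of_subset_of_card_le
        ((Finset.subset_insert_iff_of_notMem hσ.1).1 h) ?_).symm)
      rw [hρv.2, hσ.2]
    · simp

/-- The `k`-faces, indexed in two ways. -/
def faceEquiv (T : PreAbstractSimplicialComplex (Fin n)) (k : ℕ) :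
    Face T (k + 1) ≃ kFaces T k :=
  Equiv.subtypeEquivRight fun σ => by
    simp only [kFaces, Finset.mem_filter, Finset.mem_univ, true_and]
    refine and_congr_left fun h => or_iff_right ?_
    rintro rfl
    simp at h

theorem faceEquiv_coe (σ : Face T (k + 1)) : (faceEquiv T k σ : Finset (Fin n)) = σ.1 := rfl

theorem IsQAcyclic.restrict_boundary (hT : IsQAcyclic T k) {R : Type} [CommRing R] {v : Fin n}
    (e : (univ.erase v).powersetCard k ≃ kFaces T k)
    (w : (univ.erase v).powersetCard k → R) :
    restrict hT R v (boundary R T k fun τ => w (e.symm (faceEquiv T k τ))) =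
      ((redMat (fun _ => (1 : R)) (kFaces T k) v k).submatrix id e) *ᵥ w := by
  ext σ
  rw [restrict_apply, boundary_apply]
  simp only [mulVec, dotProduct, submatrix_apply, redMat, id]
  refine Fintype.sum_equiv ((faceEquiv T k).trans e.symm) _ _ fun τ => ?_
  simp [faceEquiv_coe]

/-- A kernel vector gives a `k`-chain whose boundary is a cycle vanishing off `v`, hence zero. The
chain is thus a top-dimensional cycle, which acyclicity forces to be zero. -/
theorem IsQAcyclic.det_redMat_ne_zero (hT : IsQAcyclic T k) {v : Fin n}
    (e : (univ.erase v).powersetCard k ≃ kFaces T k) :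
    ((redMat (fun _ => (1 : ℚ)) (kFaces T k) v k).submatrix id e).det ≠ 0 := by
  intro hdet
  obtain ⟨w, hw, hAw⟩ := Matrix.exists_mulVec_eq_zero_iff.2 hdet
  rw [← hT.restrict_boundary e] at hAw
  set w' : Face T (k + 1) → ℚ := fun τ => w (e.symm (faceEquiv T k τ)) with hw'
  have hcyc : w' ∈ cycles ℚ T (k + 1) :=
    LinearMap.mem_ker.2 (hT.eq_zero_of_restrict_eq_zero (hT.boundary_mem_cycles w') hAw)
  have htop := Submodule.Quotient.subsingleton_iff.1 hT.top_homology
  have hmem : (⟨w', hcyc⟩ : cycles ℚ T (k + 1)) ∈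
      (boundaries ℚ T (k + 1)).submoduleOf (cycles ℚ T (k + 1)) := by
    rw [htop]; exact Submodule.mem_top
  obtain ⟨u, hu⟩ := LinearMap.mem_range.1 (Submodule.mem_comap.1 hmem)
  have hempty : IsEmpty (Face T (k + 1 + 1)) := by
    refine ⟨fun σ => ?_⟩
    rcases σ.2.1 with h | h
    · have := σ.2.2
      rw [h] at this
      simp at this
    · have := hT.card_le σ.1 h
      have := σ.2.2
      omega
  have h0 : w' = 0 := by
    have h : boundary ℚ T (k + 1) u = w' := hu
    rw [← h, Subsingleton.elim u 0, map_zero]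
  refine hw (funext fun σ => ?_)
  have := congrFun h0 ((faceEquiv T k).symm (e σ))
  simpa [hw'] using this

theorem IsQAcyclic.det_redMat_int_ne_zero (hT : IsQAcyclic T k) {v : Fin n}
    (e : (univ.erase v).powersetCard k ≃ kFaces T k) :
    ((redMat (fun _ => (1 : ℤ)) (kFaces T k) v k).submatrix id e).det ≠ 0 := by
  intro h
  refine hT.det_redMat_ne_zero e ?_
  have := congrArg (Int.castRingHom ℚ) h
  rw [RingHom.map_det, map_zero] at this
  rw [← this]
  congr 1
  ext σ τ
  simpa [redMat] using (map_coef (Int.castRingHom ℚ) (fun _ => 1) σ.1 (e τ).1).symm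

theorem IsQAcyclic.card_redHomology (hT : IsQAcyclic T k) {v : Fin n}
    (e : (univ.erase v).powersetCard k ≃ kFaces T k) :
    Nat.card (RedHomology ℤ T k) =
      ((redMat (fun _ => (1 : ℤ)) (kFaces T k) v k).submatrix id e).det.natAbs := by
  rw [← card_quotient_range_mulVecLin (hT.det_redMat_int_ne_zero e)]
  let E : cycles ℤ T k ≃ₗ[ℤ] ((univ.erase v).powersetCard k → ℤ) :=
    LinearEquiv.ofBijective ((restrict hT ℤ v).comp (cycles ℤ T k).subtype) (by
      refine ⟨?_, fun a => ?_⟩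
      · rw [← LinearMap.ker_eq_bot]
        refine (Submodule.eq_bot_iff _).2 fun z hz => Subtype.ext ?_
        exact hT.eq_zero_of_restrict_eq_zero z.2 (LinearMap.mem_ker.1 hz)
      · obtain ⟨z, hz, hza⟩ := hT.exists_cycle_restrict_eq v a
        exact ⟨⟨z, hz⟩, hza⟩)
  refine Nat.card_congr (Submodule.Quotient.equiv _ _ E ?_).toEquiv
  ext a
  simp only [Submodule.mem_map, LinearMap.mem_range, mulVecLin_apply]
  constructor
  · rintro ⟨z, hz, rfl⟩
    obtain ⟨u, hu⟩ := LinearMap.mem_range.1 (Submodule.mem_comap.1 hz)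
    refine ⟨fun σ => u ((faceEquiv T k).symm (e σ)), ?_⟩
    rw [← hT.restrict_boundary e]
    simp only [Equiv.apply_symm_apply, Equiv.symm_apply_apply]
    exact congrArg (restrict hT ℤ v) hu
  · rintro ⟨w, rfl⟩
    rw [← hT.restrict_boundary e]
    exact ⟨⟨_, hT.boundary_mem_cycles _⟩, LinearMap.mem_range.2 ⟨_, rfl⟩, rfl⟩

end QAcyclic

/-! ### The inequality, first without zero coordinates, then in the limit. -/

namespace QAcyclic

open Finset Matrix Filter Topology

variable {n k : ℕ} {T : PreAbstractSimplicialComplex (Fin n)}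

/-- The real-valued expression underlying `boundExpr`. -/
noncomputable def realBound (T : PreAbstractSimplicialComplex (Fin n)) (k : ℕ) (x : Fin n → ℝ) : ℝ :=
  (∏ i, (x i ^ 2) ^ ((m₁ n k : ℤ) - (degree T k i : ℤ))) / (∑ i, x i ^ 2) ^ m₁ n k
    * ∏ τ ∈ kFaces T k, ∑ i ∈ τ, x i ^ 2

theorem card_of_mem_kFaces {τ : Finset (Fin n)} (h : τ ∈ kFaces T k) : τ.card = k + 1 := by
  simp only [kFaces, Finset.mem_filter] at h
  exact h.2.2

theorem IsQAcyclic.nonempty_equiv (hT : IsQAcyclic T k) (v : Fin n) :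
    Nonempty ((univ.erase v).powersetCard k ≃ kFaces T k) := by
  refine ⟨Fintype.equivOfCardEq ?_⟩
  rw [Fintype.card_coe, Fintype.card_coe, hT.card_kFaces, Finset.card_powersetCard,
    Finset.card_erase_of_mem (Finset.mem_univ v), Finset.card_univ, Fintype.card_fin]

theorem IsQAcyclic.exists_vertex (hT : IsQAcyclic T k) : ∃ _ : Fin n, True := by
  obtain ⟨τ, -, hτ⟩ := hT.exists_face
  obtain ⟨v, -⟩ := Finset.card_pos.1 (hτ ▸ k.succ_pos : 0 < τ.card)
  exact ⟨v, trivial⟩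

theorem IsQAcyclic.card_redHomology_ne_zero (hT : IsQAcyclic T k) :
    Nat.card (RedHomology ℤ T k) ≠ 0 := by
  obtain ⟨v, -⟩ := hT.exists_vertex
  obtain ⟨e⟩ := hT.nonempty_equiv v
  rw [hT.card_redHomology e, Int.natAbs_ne_zero]
  exact hT.det_redMat_int_ne_zero e

theorem IsQAcyclic.card_sq_eq (hT : IsQAcyclic T k) {v : Fin n}
    (e : (univ.erase v).powersetCard k ≃ kFaces T k) :
    (Nat.card (RedHomology ℤ T k) : ℝ) ^ 2 =
      ((redMat (fun _ => (1 : ℝ)) (kFaces T k) v k).submatrix id e).det ^ 2 := by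
  have : ((redMat (fun _ => (1 : ℝ)) (kFaces T k) v k).submatrix id e).det =
      (((redMat (fun _ => (1 : ℤ)) (kFaces T k) v k).submatrix id e).det : ℝ) := by
    rw [← eq_intCast (Int.castRingHom ℝ), RingHom.map_det]
    congr 1
    ext σ τ
    simpa [redMat] using (map_coef (Int.castRingHom ℝ) (fun _ => 1) σ.1 (e τ).1).symm
  rw [this, hT.card_redHomology e, Nat.cast_natAbs, Int.cast_abs, sq_abs]

theorem IsQAcyclic.card_sq_le_of_forall_ne_zero (hT : IsQAcyclic T k) {x : Fin n → ℝ}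
    (hx : ∀ i, x i ≠ 0) : (Nat.card (RedHomology ℤ T k) : ℝ) ^ 2 ≤ realBound T k x := by
  obtain ⟨v, -⟩ := hT.exists_vertex
  obtain ⟨e⟩ := hT.nonempty_equiv v
  have h := det_gram_mul hx (fun τ => card_of_mem_kFaces) e
  rw [← hT.card_sq_eq e, Fintype.card_fin] at h
  have hpos : ∀ i, 0 < x i ^ 2 := fun i => by have := hx i; positivity
  have hS : 0 < ∑ i, x i ^ 2 := Finset.sum_pos (fun i _ => hpos i) ⟨v, Finset.mem_univ v⟩
  have hd : 0 < ∏ i, (x i ^ 2) ^ degree T k i :=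
    Finset.prod_pos fun i _ => pow_pos (hpos i) _
  have hz : ∏ i, (x i ^ 2) ^ ((m₁ n k : ℤ) - (degree T k i : ℤ)) =
      (∏ i, (x i ^ 2) ^ m₁ n k) / ∏ i, (x i ^ 2) ^ degree T k i := by
    rw [← Finset.prod_div_distrib]
    refine Finset.prod_congr rfl fun i _ => ?_
    rw [zpow_sub₀ (hpos i).ne', zpow_natCast, zpow_natCast]
  rw [realBound, hz, div_div, div_mul_eq_mul_div, le_div_iff₀ (mul_pos hd (pow_pos hS _)),
    ← mul_assoc, mul_comm (∏ i, (x i ^ 2) ^ m₁ n k)]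
  refine h.symm.trans_le (mul_le_mul_of_nonneg_right (det_gram_le x _) ?_)
  exact Finset.prod_nonneg fun i _ => (pow_pos (hpos i) _).le

/-- Replace zero coordinates by `ε ≠ 0` and let `ε → 0`: by `hd` the powers at those coordinates
have nonnegative exponents, hence are continuous. -/
theorem IsQAcyclic.card_sq_le (hT : IsQAcyclic T k) {x : Fin n → ℝ} (hx : x ≠ 0)
    (hd : ∀ i, x i = 0 → degree T k i ≤ m₁ n k) :
    (Nat.card (RedHomology ℤ T k) : ℝ) ^ 2 ≤ realBound T k x := by
  let y : ℝ → Fin n → ℝ := fun ε i => if x i = 0 then ε else x i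
  have hy0 : y 0 = x := by
    funext i
    simp only [y]
    split_ifs with h <;> simp [h]
  have hyc : ∀ i, Continuous fun ε => y ε i := fun i => by
    by_cases h : x i = 0
    · simpa [y, h] using continuous_id'
    · simpa [y, h] using continuous_const
  have hcont : ContinuousAt (fun ε => realBound T k (y ε)) 0 := by
    unfold realBound
    refine ContinuousAt.mul (ContinuousAt.div ?_ ?_ ?_) ?_
    · refine tendsto_finsetProd _ fun i _ => ?_
      refine ContinuousAt.zpow₀ ((hyc i).continuousAt.pow 2) _ ?_
      by_cases h : x i = 0
      · right
        have := hd i h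
        omega
      · left
        simp [y, h]
    · exact (Continuous.pow (continuous_finsetSum _ fun i _ => (hyc i).pow 2) _).continuousAt
    · rw [hy0]
      obtain ⟨i, hi⟩ := Function.ne_iff.1 hx
      refine pow_ne_zero _ (Finset.sum_pos' (fun i _ => sq_nonneg _) ⟨i, Finset.mem_univ i, ?_⟩).ne'
      have : x i ≠ 0 := hi
      positivity
    · exact (continuous_finsetProd _ fun τ _ =>
        continuous_finsetSum _ fun i _ => (hyc i).pow 2).continuousAt
  have ht : Tendsto (fun ε => realBound T k (y ε)) (𝓝[≠] 0) (𝓝 (realBound T k x)) := by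
    have := hcont.tendsto
    rw [hy0] at this
    exact this.mono_left nhdsWithin_le_nhds
  refine ge_of_tendsto ht ?_
  filter_upwards [self_mem_nhdsWithin] with ε hε
  refine hT.card_sq_le_of_forall_ne_zero fun i => ?_
  simp only [y]
  split_ifs with h
  · exact hε
  · exact h

end QAcyclic

theorem theorem2 (n k : ℕ) (T : PreAbstractSimplicialComplex (Fin n))
    (hT : QAcyclic.IsQAcyclic T k) :
    Finite (QAcyclic.RedHomology ℤ T k) ∧
      (Nat.card (QAcyclic.RedHomology ℤ T k) : ℝ≥0∞) ^ 2 ≤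
        ⨅ x : {x : Fin n → ℝ // x ≠ 0}, QAcyclic.boundExpr T k x.1 := by
  refine ⟨Nat.finite_of_card_ne_zero hT.card_redHomology_ne_zero, le_iInf fun x => ?_⟩
  unfold QAcyclic.boundExpr
  split_ifs with h
  · exact le_top
  · push Not at h
    have hle := ENNReal.ofReal_le_ofReal (hT.card_sq_le x.2 h)
    rwa [ENNReal.ofReal_pow (Nat.cast_nonneg _), ENNReal.ofReal_natCast] at hle
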